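/- Let $\mathcal V$ be a monoidal category with finite limits whose unit $1$ is a terminal object, and let $$j=\langle p,q\rangle : A\otimes B\to A\times B,\qquad p: A\otimes B\to A\otimes 1\cong A,\quad q: A\otimes B\to 1\otimes B\cong B,$$ be the canonical maps. Let $Cat(\mathcal V)$ be the category of internal categories $\mathbb C=(\mathbb C_0,\mathbb C_1,\mathbb C_2,\mathit{dom},\mathit{cod},i,\mathit{comp})$ in $\mathcal V$ (with $\mathbb C_2$ the pullback of $\mathit{cod}$ and $\mathit{dom}$, with projections $\pi_1,\pi_2$) and internal functors. For internal categories $\mathbb C,\mathbb D$ the internal tensor $\mathbb C\otimes\mathbb D$ is the following internal category. Its object of objects is $(\mathbb C\otimes\mathbb D)_0=\mathbb C_0\otimes\mathbb D_0$. Its object of arrows $(\mathbb C\otimes\mathbb D)_1$, with projections $\mathit{dom}$, $j_1$, $\mathit{cod}$ to $\mathbb C_0\otimes\mathbb D_0$, $\mathbb C_1\times\mathbb D_1$, $\mathbb C_0\otimes\mathbb D_0$, is the limit of $$\mathbb C_0\otimes\mathbb D_0\xrightarrow{\;j\;}\mathbb C_0\times\mathbb D_0\xleftarrow{\mathit{dom}\times\mathit{dom}}\mathbb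 C_1\times\mathbb D_1\xrightarrow{\mathit{cod}\times\mathit{cod}}\mathbb C_0\times\mathbb D_0\xleftarrow{\;j\;}\mathbb C_0\otimes\mathbb D_0 .$$ The identity map $i$ is determined by $\mathit{dom}\circ i=\mathit{id}=\mathit{cod}\circ i$ and $j_1\circ i=(i\times i)\circ j$. With $(\mathbb C\otimes\mathbb D)_2$ the pullback of $\mathit{cod}$ and $\mathit{dom}$, and $j_2:(\mathbb C\otimes\mathbb D)_2\to\mathbb C_2\times\mathbb D_2$ the map induced by $j_1$, composition is determined by $\mathit{dom}\circ\mathit{comp}=\mathit{dom}\circ\pi_1$, $\mathit{cod}\circ\mathit{comp}=\mathit{cod}\circ\pi_2$ and $j_1\circ\mathit{comp}=(\mathit{comp}\times\mathit{comp})\circ j_2$. For internal functors $f:\mathbb C\to\mathbb C'$ and $g:\mathbb D\to\mathbb D'$, $f\otimes g$ is the internal functor with $(f\otimes g)_0=f_0\otimes g_0$ and $j_1\circ(f\otimes g)_1=(f_1\times g_1)\circ j_1$. Let $\mathbb 1$ be the internal category with $\mathbb 1_0=\mathbb 1_1=\mathbb 1_2=1$ and all structure maps identities. **Theorem.** $(Cat(\mathcal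 V),\mathbb 1,\otimes)$ is a monoidal category, with an associator and unitors whose components on objects are the associator and unitors of $\mathcal V$ and which on arrows are compatible with the projections $(\mathbb C\otimes\mathbb D)_1\to\mathbb C_1$ and $(\mathbb C\otimes\mathbb D)_1\to\mathbb D_1$ obtained from $j_1$. If moreover $\mathcal V$ is symmetric monoidal, then $(Cat(\mathcal V),\mathbb 1,\otimes)$, with this associator and these unitors, is a symmetric monoidal category, with a symmetry whose component on objects is the symmetry of $\mathcal V$ and which on arrows exchanges the two projections. -/

import Mathlib

open CategoryTheory CategoryTheory.Limits MonoidalCategory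

universe v u

/-- A category internal to a category `V` with finite limits: an object of objects `A₀`, an object
of arrows `A₁` and an object of composable pairs `A₂`, with the structure maps and the laws below.
In `A₂` the first projection is the arrow that is applied first. -/
structure IntCat (V : Type u) [Category.{v} V] [HasFiniteLimits V] where
  A₀ : V
  A₁ : V
  A₂ : V
  dom : A₁ ⟶ A₀
  cod : A₁ ⟶ A₀
  /-- the identity arrows -/
  i : A₀ ⟶ A₁
  π₁ : A₂ ⟶ A₁
  π₂ : A₂ ⟶ A₁
  comp : A₂ ⟶ A₁
  isPullback : IsPullback π₁ π₂ cod dom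
  comp_dom : comp ≫ dom = π₁ ≫ dom
  comp_cod : comp ≫ cod = π₂ ≫ cod
  i_dom : i ≫ dom = 𝟙 A₀
  i_cod : i ≫ cod = 𝟙 A₀
  /-- `comp ∘ ⟨i ∘ dom, id⟩ = id` -/
  id_comp : isPullback.lift (dom ≫ i) (𝟙 A₁)
    (by rw [Category.assoc, i_cod, Category.comp_id, Category.id_comp]) ≫ comp = 𝟙 A₁
  /-- `comp ∘ ⟨id, i ∘ cod⟩ = id` -/
  comp_id : isPullback.lift (𝟙 A₁) (cod ≫ i)
    (by rw [Category.assoc, i_dom, Category.comp_id, Category.id_comp]) ≫ comp = 𝟙 A₁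
  /-- `comp ∘ compl = comp ∘ compr`, as maps out of the object of composable triples, which is the
  pullback of `π₂` and `π₁`, with projections `left = pullback.fst π₂ π₁` and
  `right = pullback.snd π₂ π₁`. -/
  assoc :
    isPullback.lift (pullback.fst π₂ π₁ ≫ comp) (pullback.snd π₂ π₁ ≫ π₂)
      (by rw [Category.assoc, comp_cod, Category.assoc, ← isPullback.w,
            pullback.condition_assoc]) ≫ comp =
    isPullback.lift (pullback.fst π₂ π₁ ≫ π₁) (pullback.snd π₂ π₁ ≫ comp)
      (by rw [Category.assoc, isPullback.w, pullback.condition_assoc, Category.assoc,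
            comp_dom]) ≫ comp

namespace IntCat

section Basic

variable {V : Type u} [Category.{v} V] [HasFiniteLimits V]

/-- Associativity of composition, for composable triples indexed by `T`. -/
theorem comp_assoc (A : IntCat V) {T : V} {l r p q : T ⟶ A.A₂} (w : l ≫ A.π₂ = r ≫ A.π₁)
    (p₁ : p ≫ A.π₁ = l ≫ A.comp) (p₂ : p ≫ A.π₂ = r ≫ A.π₂)
    (q₁ : q ≫ A.π₁ = l ≫ A.π₁) (q₂ : q ≫ A.π₂ = r ≫ A.comp) : p ≫ A.comp = q ≫ A.comp := by
  have h := (Category.assoc _ _ _).trans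
    ((pullback.lift l r w ≫= A.assoc).trans (Category.assoc _ _ _).symm)
  refine Eq.trans ?_ (h.trans ?_)
  · congr 1
    apply A.isPullback.hom_ext
    · rw [Category.assoc, IsPullback.lift_fst, pullback.lift_fst_assoc, p₁]
    · rw [Category.assoc, IsPullback.lift_snd, pullback.lift_snd_assoc, p₂]
  · congr 1
    apply A.isPullback.hom_ext
    · rw [Category.assoc, IsPullback.lift_fst, pullback.lift_fst_assoc, q₁]
    · rw [Category.assoc, IsPullback.lift_snd, pullback.lift_snd_assoc, q₂]

/-- Internal functors: triples `(f₀, f₁, f₂)` that commute with `dom`, `cod`, `comp` and the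
identities, where `f₂` is the map induced by `f₁` on composable pairs. -/
structure Hom (A B : IntCat V) where
  f₀ : A.A₀ ⟶ B.A₀
  f₁ : A.A₁ ⟶ B.A₁
  f₂ : A.A₂ ⟶ B.A₂
  dom_comm : A.dom ≫ f₀ = f₁ ≫ B.dom
  cod_comm : A.cod ≫ f₀ = f₁ ≫ B.cod
  i_comm : A.i ≫ f₁ = f₀ ≫ B.i
  π₁_comm : A.π₁ ≫ f₁ = f₂ ≫ B.π₁
  π₂_comm : A.π₂ ≫ f₁ = f₂ ≫ B.π₂
  comp_comm : A.comp ≫ f₁ = f₂ ≫ B.comp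

/-- An internal functor is determined by its components on objects and on arrows. -/
theorem Hom.ext₀₁ {A B : IntCat V} {f g : Hom A B} (h₀ : f.f₀ = g.f₀) (h₁ : f.f₁ = g.f₁) :
    f = g := by
  have h₂ : f.f₂ = g.f₂ := by
    apply B.isPullback.hom_ext
    · rw [← f.π₁_comm, ← g.π₁_comm, h₁]
    · rw [← f.π₂_comm, ← g.π₂_comm, h₁]
  cases f
  cases g
  cases h₀
  cases h₁
  cases h₂
  rfl

/-- The category `Cat(V)` of internal categories and internal functors. -/
instance : Category.{v} (IntCat V) where
  Hom := Hom
  id A :=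
    { f₀ := 𝟙 _, f₁ := 𝟙 _, f₂ := 𝟙 _
      dom_comm := by simp
      cod_comm := by simp
      i_comm := by simp
      π₁_comm := by simp
      π₂_comm := by simp
      comp_comm := by simp }
  comp {A B C} f g :=
    { f₀ := f.f₀ ≫ g.f₀, f₁ := f.f₁ ≫ g.f₁, f₂ := f.f₂ ≫ g.f₂
      dom_comm := by rw [← Category.assoc, f.dom_comm, Category.assoc, g.dom_comm, Category.assoc]
      cod_comm := by rw [← Category.assoc, f.cod_comm, Category.assoc, g.cod_comm, Category.assoc]
      i_comm := by rw [← Category.assoc, f.i_comm, Category.assoc, g.i_comm, Category.assoc]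
      π₁_comm := by rw [← Category.assoc, f.π₁_comm, Category.assoc, g.π₁_comm, Category.assoc]
      π₂_comm := by rw [← Category.assoc, f.π₂_comm, Category.assoc, g.π₂_comm, Category.assoc]
      comp_comm := by
        rw [← Category.assoc, f.comp_comm, Category.assoc, g.comp_comm, Category.assoc] }
  id_comp f := Hom.ext₀₁ (Category.id_comp f.f₀) (Category.id_comp f.f₁)
  comp_id f := Hom.ext₀₁ (Category.comp_id f.f₀) (Category.comp_id f.f₁)
  assoc f g h := Hom.ext₀₁ (Category.assoc f.f₀ g.f₀ h.f₀) (Category.assoc f.f₁ g.f₁ h.f₁)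

/-- The product of the two pullback squares of composable pairs is a pullback square. -/
theorem isPullback_prod (C D : IntCat V) :
    IsPullback (prod.map C.π₁ D.π₁) (prod.map C.π₂ D.π₂)
      (prod.map C.cod D.cod) (prod.map C.dom D.dom) := by
  refine ⟨⟨by rw [prod.map_map, prod.map_map, C.isPullback.w, D.isPullback.w]⟩,
    ⟨PullbackCone.IsLimit.mk _
      (fun s => prod.lift
        (C.isPullback.lift (s.fst ≫ prod.fst) (s.snd ≫ prod.fst)
          (by simpa using s.condition =≫ prod.fst))
        (D.isPullback.lift (s.fst ≫ prod.snd) (s.snd ≫ prod.snd)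
          (by simpa using s.condition =≫ prod.snd))) ?_ ?_ ?_⟩⟩
  · intro s
    apply Limits.prod.hom_ext <;> simp [prod.lift_fst, prod.lift_snd]
  · intro s
    apply Limits.prod.hom_ext <;> simp [prod.lift_fst, prod.lift_snd]
  · intro s m h₁ h₂
    apply Limits.prod.hom_ext
    · apply C.isPullback.hom_ext
      · simpa [prod.lift_fst_assoc, prod.lift_fst] using h₁ =≫ prod.fst
      · simpa [prod.lift_fst_assoc, prod.lift_fst] using h₂ =≫ prod.fst
    · apply D.isPullback.hom_ext
      · simpa [prod.lift_snd_assoc, prod.lift_snd] using h₁ =≫ prod.snd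
      · simpa [prod.lift_snd_assoc, prod.lift_snd] using h₂ =≫ prod.snd

end Basic

noncomputable section Tensor

variable {V : Type u} [Category.{v} V] [SemiCartesianMonoidalCategory V] [HasFiniteLimits V]

/-- The canonical map `A ⊗ B ⟶ A × B`. -/
def j (A B : V) : A ⊗ B ⟶ A ⨯ B :=
  prod.lift (SemiCartesianMonoidalCategory.fst A B) (SemiCartesianMonoidalCategory.snd A B)

/-- The canonical map `j` is natural. -/
theorem j_natural {A A' B B' : V} (f : A ⟶ A') (g : B ⟶ B') :
    (f ⊗ₘ g) ≫ j A' B' = j A B ≫ prod.map f g := by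
  have e₁ : (f ⊗ₘ g) ≫ SemiCartesianMonoidalCategory.fst A' B' =
      SemiCartesianMonoidalCategory.fst A B ≫ f := by
    rw [SemiCartesianMonoidalCategory.fst_def, SemiCartesianMonoidalCategory.fst_def,
      Category.assoc, ← rightUnitor_naturality, MonoidalCategory.tensorHom_def, Category.assoc,
      ← MonoidalCategory.whiskerLeft_comp_assoc, ← Category.assoc, ← Category.assoc,
      MonoidalCategory.whisker_exchange]
    congr 3
    exact SemiCartesianMonoidalCategory.toUnit_unique _ _
  have e₂ : (f ⊗ₘ g) ≫ SemiCartesianMonoidalCategory.snd A' B' =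
      SemiCartesianMonoidalCategory.snd A B ≫ g := by
    rw [SemiCartesianMonoidalCategory.snd_def, SemiCartesianMonoidalCategory.snd_def,
      Category.assoc, ← leftUnitor_naturality, MonoidalCategory.tensorHom_def', Category.assoc,
      ← MonoidalCategory.comp_whiskerRight_assoc, ← Category.assoc, ← Category.assoc,
      ← MonoidalCategory.whisker_exchange]
    congr 3
    exact SemiCartesianMonoidalCategory.toUnit_unique _ _
  apply Limits.prod.hom_ext
  · simp [j, prod.lift_fst, e₁]
  · simp [j, prod.lift_snd, e₂]

/-- The object of arrows `(C ⊗ D)₁`: the limit of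
`C₀ ⊗ D₀ ⟶ C₀ × D₀ ⟵ C₁ × D₁ ⟶ C₀ × D₀ ⟵ C₀ ⊗ D₀`, where the outer maps are `j`
and the inner ones are `dom × dom` and `cod × cod`. The universal property is stated in `arrLift`,
its three computation rules, and `arr_hom_ext`. -/
abbrev arr (C D : IntCat V) : V :=
  pullback (pullback.fst (prod.map C.dom D.dom) (j C.A₀ D.A₀) ≫ prod.map C.cod D.cod)
    (j C.A₀ D.A₀)

/-- The limit projection `j₁ : (C ⊗ D)₁ ⟶ C₁ × D₁`. -/
def j₁ (C D : IntCat V) : arr C D ⟶ C.A₁ ⨯ D.A₁ :=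
  pullback.fst _ _ ≫ pullback.fst _ _

/-- The limit projection `dom : (C ⊗ D)₁ ⟶ C₀ ⊗ D₀`. -/
def arrDom (C D : IntCat V) : arr C D ⟶ C.A₀ ⊗ D.A₀ :=
  pullback.fst _ _ ≫ pullback.snd _ _

/-- The limit projection `cod : (C ⊗ D)₁ ⟶ C₀ ⊗ D₀`. -/
def arrCod (C D : IntCat V) : arr C D ⟶ C.A₀ ⊗ D.A₀ :=
  pullback.snd _ _

theorem arrDom_j (C D : IntCat V) :
    arrDom C D ≫ j C.A₀ D.A₀ = j₁ C D ≫ prod.map C.dom D.dom := by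
  rw [arrDom, j₁, Category.assoc, Category.assoc, pullback.condition]

theorem arrCod_j (C D : IntCat V) :
    arrCod C D ≫ j C.A₀ D.A₀ = j₁ C D ≫ prod.map C.cod D.cod := by
  rw [arrCod, j₁, Category.assoc, pullback.condition]

/-- The arrow into the limit `(C ⊗ D)₁` that is given by a cone. -/
def arrLift (C D : IntCat V) {T : V} (d c : T ⟶ C.A₀ ⊗ D.A₀) (k : T ⟶ C.A₁ ⨯ D.A₁)
    (hd : d ≫ j C.A₀ D.A₀ = k ≫ prod.map C.dom D.dom)
    (hc : c ≫ j C.A₀ D.A₀ = k ≫ prod.map C.cod D.cod) : T ⟶ arr C D :=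
  pullback.lift (pullback.lift k d hd.symm) c (by rw [pullback.lift_fst_assoc, hc])

section

variable (C D : IntCat V) {T : V} (d c : T ⟶ C.A₀ ⊗ D.A₀) (k : T ⟶ C.A₁ ⨯ D.A₁)
    (hd : d ≫ j C.A₀ D.A₀ = k ≫ prod.map C.dom D.dom)
    (hc : c ≫ j C.A₀ D.A₀ = k ≫ prod.map C.cod D.cod)

theorem arrLift_dom : arrLift C D d c k hd hc ≫ arrDom C D = d := by
  rw [arrLift, arrDom, pullback.lift_fst_assoc, pullback.lift_snd]

theorem arrLift_cod : arrLift C D d c k hd hc ≫ arrCod C D = c := by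
  rw [arrLift, arrCod, pullback.lift_snd]

theorem arrLift_j₁ : arrLift C D d c k hd hc ≫ j₁ C D = k := by
  rw [arrLift, j₁, pullback.lift_fst_assoc, pullback.lift_fst]

end

theorem arr_hom_ext (C D : IntCat V) {T : V} {f g : T ⟶ arr C D}
    (hd : f ≫ arrDom C D = g ≫ arrDom C D) (hc : f ≫ arrCod C D = g ≫ arrCod C D)
    (hj : f ≫ j₁ C D = g ≫ j₁ C D) : f = g := by
  apply pullback.hom_ext
  · apply pullback.hom_ext
    · simpa [j₁] using hj
    · simpa [arrDom] using hd
  · simpa [arrCod] using hc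

/-- The identities `(C ⊗ D)₀ ⟶ (C ⊗ D)₁`. -/
def arrI (C D : IntCat V) : C.A₀ ⊗ D.A₀ ⟶ arr C D :=
  arrLift C D (𝟙 _) (𝟙 _) (j C.A₀ D.A₀ ≫ prod.map C.i D.i)
    (by simp [C.i_dom, D.i_dom]) (by simp [C.i_cod, D.i_cod])

/-- The object of composable pairs `(C ⊗ D)₂`. -/
abbrev arr₂ (C D : IntCat V) : V := pullback (arrCod C D) (arrDom C D)

/-- The map `j₂ : (C ⊗ D)₂ ⟶ C₂ × D₂` induced by `j₁`. -/
def j₂ (C D : IntCat V) : arr₂ C D ⟶ C.A₂ ⨯ D.A₂ :=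
  (isPullback_prod C D).lift (pullback.fst _ _ ≫ j₁ C D) (pullback.snd _ _ ≫ j₁ C D)
    (by rw [Category.assoc, Category.assoc, ← arrCod_j, ← arrDom_j, pullback.condition_assoc])

theorem j₂_π₁ (C D : IntCat V) :
    j₂ C D ≫ prod.map C.π₁ D.π₁ = pullback.fst _ _ ≫ j₁ C D :=
  (isPullback_prod C D).lift_fst _ _ _

theorem j₂_π₂ (C D : IntCat V) :
    j₂ C D ≫ prod.map C.π₂ D.π₂ = pullback.snd _ _ ≫ j₁ C D :=
  (isPullback_prod C D).lift_snd _ _ _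

/-- The composition `(C ⊗ D)₂ ⟶ (C ⊗ D)₁`. -/
def arrComp (C D : IntCat V) : arr₂ C D ⟶ arr C D :=
  arrLift C D (pullback.fst _ _ ≫ arrDom C D) (pullback.snd _ _ ≫ arrCod C D)
    (j₂ C D ≫ prod.map C.comp D.comp)
    (by
      rw [Category.assoc, arrDom_j, Category.assoc, prod.map_map, C.comp_dom, D.comp_dom,
        ← prod.map_map, ← Category.assoc, ← j₂_π₁, Category.assoc])
    (by
      rw [Category.assoc, arrCod_j, Category.assoc, prod.map_map, C.comp_cod, D.comp_cod,
        ← prod.map_map, ← Category.assoc, ← j₂_π₂, Category.assoc])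

theorem arrComp_dom (C D : IntCat V) :
    arrComp C D ≫ arrDom C D = pullback.fst _ _ ≫ arrDom C D :=
  arrLift_dom ..

theorem arrComp_cod (C D : IntCat V) :
    arrComp C D ≫ arrCod C D = pullback.snd _ _ ≫ arrCod C D :=
  arrLift_cod ..

theorem arrComp_j₁ (C D : IntCat V) :
    arrComp C D ≫ j₁ C D = j₂ C D ≫ prod.map C.comp D.comp :=
  arrLift_j₁ ..

/-- If `h` is a `T`-indexed family of composable pairs of `C ⊗ D` lying over the family `h'` of
composable pairs of `C` and `D`, then `j₂ ∘ h = h'`. -/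
theorem comp_j₂ (C D : IntCat V) {T : V} (h : T ⟶ arr₂ C D) (h' : T ⟶ C.A₂ ⨯ D.A₂)
    (e₁ : h ≫ pullback.fst _ _ ≫ j₁ C D = h' ≫ prod.map C.π₁ D.π₁)
    (e₂ : h ≫ pullback.snd _ _ ≫ j₁ C D = h' ≫ prod.map C.π₂ D.π₂) :
    h ≫ j₂ C D = h' := by
  apply (isPullback_prod C D).hom_ext
  · rw [Category.assoc, j₂_π₁, e₁]
  · rw [Category.assoc, j₂_π₂, e₂]

theorem arrI_dom (C D : IntCat V) : arrI C D ≫ arrDom C D = 𝟙 _ := arrLift_dom ..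

theorem arrI_cod (C D : IntCat V) : arrI C D ≫ arrCod C D = 𝟙 _ := arrLift_cod ..

theorem arrI_j₁ (C D : IntCat V) :
    arrI C D ≫ j₁ C D = j C.A₀ D.A₀ ≫ prod.map C.i D.i := arrLift_j₁ ..

/-- Associativity of the composition of `C ⊗ D`, for composable triples indexed by `T`. -/
theorem arr_assoc (C D : IntCat V) {T : V} {l r p q : T ⟶ arr₂ C D}
    (w : l ≫ pullback.snd _ _ = r ≫ pullback.fst _ _)
    (p₁ : p ≫ pullback.fst _ _ = l ≫ arrComp C D)
    (p₂ : p ≫ pullback.snd _ _ = r ≫ pullback.snd _ _)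
    (q₁ : q ≫ pullback.fst _ _ = l ≫ pullback.fst _ _)
    (q₂ : q ≫ pullback.snd _ _ = r ≫ arrComp C D) :
    p ≫ arrComp C D = q ≫ arrComp C D := by
  have w' : (l ≫ j₂ C D) ≫ prod.map C.π₂ D.π₂ = (r ≫ j₂ C D) ≫ prod.map C.π₁ D.π₁ := by
    rw [Category.assoc, j₂_π₂, Category.assoc, j₂_π₁, ← Category.assoc, w, Category.assoc]
  have p₁' : (p ≫ j₂ C D) ≫ prod.map C.π₁ D.π₁ = (l ≫ j₂ C D) ≫ prod.map C.comp D.comp := by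
    rw [Category.assoc, j₂_π₁, ← Category.assoc, p₁, Category.assoc, arrComp_j₁, Category.assoc]
  have p₂' : (p ≫ j₂ C D) ≫ prod.map C.π₂ D.π₂ = (r ≫ j₂ C D) ≫ prod.map C.π₂ D.π₂ := by
    rw [Category.assoc, j₂_π₂, ← Category.assoc, p₂, Category.assoc, ← j₂_π₂, Category.assoc]
  have q₁' : (q ≫ j₂ C D) ≫ prod.map C.π₁ D.π₁ = (l ≫ j₂ C D) ≫ prod.map C.π₁ D.π₁ := by
    rw [Category.assoc, j₂_π₁, ← Category.assoc, q₁, Category.assoc, ← j₂_π₁, Category.assoc]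
  have q₂' : (q ≫ j₂ C D) ≫ prod.map C.π₂ D.π₂ = (r ≫ j₂ C D) ≫ prod.map C.comp D.comp := by
    rw [Category.assoc, j₂_π₂, ← Category.assoc, q₂, Category.assoc, arrComp_j₁, Category.assoc]
  apply arr_hom_ext
  · rw [Category.assoc, Category.assoc, arrComp_dom, ← Category.assoc, ← Category.assoc, p₁, q₁,
      Category.assoc, Category.assoc, arrComp_dom]
  · rw [Category.assoc, Category.assoc, arrComp_cod, ← Category.assoc, ← Category.assoc, p₂, q₂,
      Category.assoc, Category.assoc, arrComp_cod]
  · rw [Category.assoc, Category.assoc, arrComp_j₁, ← Category.assoc, ← Category.assoc]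
    apply Limits.prod.hom_ext
    · simpa using C.comp_assoc (l := (l ≫ j₂ C D) ≫ prod.fst) (r := (r ≫ j₂ C D) ≫ prod.fst)
        (p := (p ≫ j₂ C D) ≫ prod.fst) (q := (q ≫ j₂ C D) ≫ prod.fst)
        (by simpa using w' =≫ prod.fst) (by simpa using p₁' =≫ prod.fst)
        (by simpa using p₂' =≫ prod.fst) (by simpa using q₁' =≫ prod.fst)
        (by simpa using q₂' =≫ prod.fst)
    · simpa using D.comp_assoc (l := (l ≫ j₂ C D) ≫ prod.snd) (r := (r ≫ j₂ C D) ≫ prod.snd)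
        (p := (p ≫ j₂ C D) ≫ prod.snd) (q := (q ≫ j₂ C D) ≫ prod.snd)
        (by simpa using w' =≫ prod.snd) (by simpa using p₁' =≫ prod.snd)
        (by simpa using p₂' =≫ prod.snd) (by simpa using q₁' =≫ prod.snd)
        (by simpa using q₂' =≫ prod.snd)

/-- The internal tensor `C ⊗ D`. -/
abbrev tensorObj (C D : IntCat V) : IntCat V where
  A₀ := C.A₀ ⊗ D.A₀
  A₁ := arr C D
  A₂ := arr₂ C D
  dom := arrDom C D
  cod := arrCod C D
  i := arrI C D
  π₁ := pullback.fst _ _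
  π₂ := pullback.snd _ _
  comp := arrComp C D
  isPullback := IsPullback.of_hasPullback _ _
  comp_dom := arrComp_dom C D
  comp_cod := arrComp_cod C D
  i_dom := arrI_dom C D
  i_cod := arrI_cod C D
  id_comp := by
    apply arr_hom_ext
    · rw [Category.assoc, arrComp_dom, IsPullback.lift_fst_assoc, Category.assoc, arrI_dom,
        Category.comp_id, Category.id_comp]
    · rw [Category.assoc, arrComp_cod, IsPullback.lift_snd_assoc]
    · rw [Category.assoc, arrComp_j₁, ← Category.assoc,
        comp_j₂ C D _ (j₁ C D ≫ prod.map
          (C.isPullback.lift (C.dom ≫ C.i) (𝟙 C.A₁) (by simp [C.i_cod]))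
          (D.isPullback.lift (D.dom ≫ D.i) (𝟙 D.A₁) (by simp [D.i_cod])))]
      · rw [Category.assoc, prod.map_map, C.id_comp, D.id_comp, prod.map_id_id,
          Category.comp_id, Category.id_comp]
      · rw [IsPullback.lift_fst_assoc, Category.assoc, arrI_j₁, Category.assoc, prod.map_map,
          IsPullback.lift_fst, IsPullback.lift_fst, ← prod.map_map, ← Category.assoc, arrDom_j,
          Category.assoc]
      · rw [IsPullback.lift_snd_assoc, Category.assoc, prod.map_map,
          IsPullback.lift_snd, IsPullback.lift_snd, prod.map_id_id,
          Category.comp_id, Category.id_comp]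
  comp_id := by
    apply arr_hom_ext
    · rw [Category.assoc, arrComp_dom, IsPullback.lift_fst_assoc]
    · rw [Category.assoc, arrComp_cod, IsPullback.lift_snd_assoc, Category.assoc, arrI_cod,
        Category.comp_id, Category.id_comp]
    · rw [Category.assoc, arrComp_j₁, ← Category.assoc,
        comp_j₂ C D _ (j₁ C D ≫ prod.map
          (C.isPullback.lift (𝟙 C.A₁) (C.cod ≫ C.i) (by simp [C.i_dom]))
          (D.isPullback.lift (𝟙 D.A₁) (D.cod ≫ D.i) (by simp [D.i_dom])))]
      · rw [Category.assoc, prod.map_map, C.comp_id, D.comp_id, prod.map_id_id,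
          Category.comp_id, Category.id_comp]
      · rw [IsPullback.lift_fst_assoc, Category.assoc, prod.map_map,
          IsPullback.lift_fst, IsPullback.lift_fst, prod.map_id_id,
          Category.comp_id, Category.id_comp]
      · rw [IsPullback.lift_snd_assoc, Category.assoc, arrI_j₁, Category.assoc, prod.map_map,
          IsPullback.lift_snd, IsPullback.lift_snd, ← prod.map_map, ← Category.assoc, arrCod_j,
          Category.assoc]
  assoc := arr_assoc C D pullback.condition (IsPullback.lift_fst _ _ _ _)
    (IsPullback.lift_snd _ _ _ _) (IsPullback.lift_fst _ _ _ _) (IsPullback.lift_snd _ _ _ _)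

/-- The internal category on the unit, all of whose structure maps are identities. -/
abbrev unit : IntCat V where
  A₀ := 𝟙_ V
  A₁ := 𝟙_ V
  A₂ := 𝟙_ V
  dom := 𝟙 _
  cod := 𝟙 _
  i := 𝟙 _
  π₁ := 𝟙 _
  π₂ := 𝟙 _
  comp := 𝟙 _
  isPullback := IsPullback.of_id_fst
  comp_dom := rfl
  comp_cod := rfl
  i_dom := Category.comp_id _
  i_cod := Category.comp_id _
  id_comp := SemiCartesianMonoidalCategory.toUnit_unique _ _
  comp_id := SemiCartesianMonoidalCategory.toUnit_unique _ _
  assoc := SemiCartesianMonoidalCategory.toUnit_unique _ _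

/-- The component of `f ⊗ g` on arrows. -/
def homArr {C C' D D' : IntCat V} (f : C ⟶ C') (g : D ⟶ D') : arr C D ⟶ arr C' D' :=
  arrLift C' D' (arrDom C D ≫ (f.f₀ ⊗ₘ g.f₀)) (arrCod C D ≫ (f.f₀ ⊗ₘ g.f₀))
    (j₁ C D ≫ prod.map f.f₁ g.f₁)
    (by
      rw [Category.assoc, j_natural, ← Category.assoc, arrDom_j, Category.assoc, Category.assoc,
        prod.map_map, prod.map_map, f.dom_comm, g.dom_comm])
    (by
      rw [Category.assoc, j_natural, ← Category.assoc, arrCod_j, Category.assoc, Category.assoc,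
        prod.map_map, prod.map_map, f.cod_comm, g.cod_comm])

theorem homArr_dom {C C' D D' : IntCat V} (f : C ⟶ C') (g : D ⟶ D') :
    homArr f g ≫ arrDom C' D' = arrDom C D ≫ (f.f₀ ⊗ₘ g.f₀) := arrLift_dom ..

theorem homArr_cod {C C' D D' : IntCat V} (f : C ⟶ C') (g : D ⟶ D') :
    homArr f g ≫ arrCod C' D' = arrCod C D ≫ (f.f₀ ⊗ₘ g.f₀) := arrLift_cod ..

theorem homArr_j₁ {C C' D D' : IntCat V} (f : C ⟶ C') (g : D ⟶ D') :
    homArr f g ≫ j₁ C' D' = j₁ C D ≫ prod.map f.f₁ g.f₁ := arrLift_j₁ ..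

/-- The internal tensor `f ⊗ g` of internal functors. -/
def tensorHom {C C' D D' : IntCat V} (f : C ⟶ C') (g : D ⟶ D') :
    tensorObj C D ⟶ tensorObj C' D' where
  f₀ := f.f₀ ⊗ₘ g.f₀
  f₁ := homArr f g
  f₂ := pullback.map _ _ _ _ (homArr f g) (homArr f g) (f.f₀ ⊗ₘ g.f₀)
    (homArr_cod f g).symm (homArr_dom f g).symm
  dom_comm := (homArr_dom f g).symm
  cod_comm := (homArr_cod f g).symm
  i_comm := by
    change arrI C D ≫ homArr f g = (f.f₀ ⊗ₘ g.f₀) ≫ arrI C' D'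
    apply arr_hom_ext
    · rw [Category.assoc, homArr_dom, ← Category.assoc, arrI_dom, Category.id_comp,
        Category.assoc, arrI_dom, Category.comp_id]
    · rw [Category.assoc, homArr_cod, ← Category.assoc, arrI_cod, Category.id_comp,
        Category.assoc, arrI_cod, Category.comp_id]
    · rw [Category.assoc, homArr_j₁, ← Category.assoc, arrI_j₁, Category.assoc, prod.map_map,
        f.i_comm, g.i_comm, Category.assoc, arrI_j₁, ← Category.assoc, j_natural, Category.assoc,
        prod.map_map]
  π₁_comm := (pullback.lift_fst _ _ _).symm
  π₂_comm := (pullback.lift_snd _ _ _).symm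
  comp_comm := by
    change arrComp C D ≫ homArr f g = pullback.map _ _ _ _ (homArr f g) (homArr f g)
      (f.f₀ ⊗ₘ g.f₀) (homArr_cod f g).symm (homArr_dom f g).symm ≫ arrComp C' D'
    have m₁ : pullback.map _ _ _ _ (homArr f g) (homArr f g) (f.f₀ ⊗ₘ g.f₀)
        (homArr_cod f g).symm (homArr_dom f g).symm ≫ pullback.fst _ _ =
        pullback.fst _ _ ≫ homArr f g := pullback.lift_fst _ _ _
    have m₂ : pullback.map _ _ _ _ (homArr f g) (homArr f g) (f.f₀ ⊗ₘ g.f₀)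
        (homArr_cod f g).symm (homArr_dom f g).symm ≫ pullback.snd _ _ =
        pullback.snd _ _ ≫ homArr f g := pullback.lift_snd _ _ _
    generalize pullback.map _ _ _ _ (homArr f g) (homArr f g) (f.f₀ ⊗ₘ g.f₀)
        (homArr_cod f g).symm (homArr_dom f g).symm = m at m₁ m₂ ⊢
    apply arr_hom_ext
    · rw [Category.assoc, homArr_dom, ← Category.assoc, arrComp_dom, Category.assoc,
        Category.assoc, arrComp_dom, ← Category.assoc m, m₁, Category.assoc, homArr_dom]
    · rw [Category.assoc, homArr_cod, ← Category.assoc, arrComp_cod, Category.assoc,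
        Category.assoc, arrComp_cod, ← Category.assoc m, m₂, Category.assoc, homArr_cod]
    · rw [Category.assoc, homArr_j₁, ← Category.assoc, arrComp_j₁, Category.assoc,
        Category.assoc, arrComp_j₁, prod.map_map, f.comp_comm, g.comp_comm, ← prod.map_map,
        ← Category.assoc, ← Category.assoc]
      congr 1
      symm
      apply comp_j₂
      · rw [← Category.assoc, m₁, Category.assoc, homArr_j₁, Category.assoc, prod.map_map,
          ← f.π₁_comm, ← g.π₁_comm, ← prod.map_map, ← Category.assoc, ← Category.assoc, j₂_π₁]
      · rw [← Category.assoc, m₂, Category.assoc, homArr_j₁, Category.assoc, prod.map_map,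
          ← f.π₂_comm, ← g.π₂_comm, ← prod.map_map, ← Category.assoc, ← Category.assoc, j₂_π₂]

/-- The internal tensor, the internal category on the unit, and a candidate associator and
candidate unitors, as the (lawless) data of a monoidal structure on `Cat(V)`. -/
abbrev tensorStruct
    (α : ∀ C D E : IntCat V, tensorObj (tensorObj C D) E ≅ tensorObj C (tensorObj D E))
    (l : ∀ C : IntCat V, tensorObj unit C ≅ C) (r : ∀ C : IntCat V, tensorObj C unit ≅ C) :
    MonoidalCategoryStruct (IntCat V) where
  tensorObj := tensorObj
  whiskerLeft C _ _ g := tensorHom (𝟙 C) g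
  whiskerRight f D := tensorHom f (𝟙 D)
  tensorHom f g := tensorHom f g
  tensorUnit := unit
  associator := α
  leftUnitor := l
  rightUnitor := r

/-- The projection `(C ⊗ D)₁ ⟶ C₁`. -/
abbrev arrFst (C D : IntCat V) : (tensorObj C D).A₁ ⟶ C.A₁ := j₁ C D ≫ prod.fst

/-- The projection `(C ⊗ D)₁ ⟶ D₁`. -/
abbrev arrSnd (C D : IntCat V) : (tensorObj C D).A₁ ⟶ D.A₁ := j₁ C D ≫ prod.snd

end Tensor

end IntCat

/-- The data `S` satisfy the laws of a monoidal category: they are the data of a monoidal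
category. -/
inductive IsMonoidal {C : Type u} [Category.{v} C] : MonoidalCategoryStruct C → Prop
  | mk (M : MonoidalCategory C) : IsMonoidal M.toMonoidalCategoryStruct

/-- The data `S` with the braiding `β` satisfy the laws of a symmetric monoidal category: they are
the data and the braiding of a symmetric monoidal category. -/
inductive IsSymmetricMonoidal {C : Type u} [Category.{v} C] :
    (S : MonoidalCategoryStruct C) → (∀ X Y : C, S.tensorObj X Y ≅ S.tensorObj Y X) → Prop
  | mk (M : MonoidalCategory C) (B : SymmetricCategory C) :
    IsSymmetricMonoidal M.toMonoidalCategoryStruct (fun X Y => B.braiding X Y)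

/-! An arrow of `C ⊗ D` consists of a source and a target in `C₀ ⊗ D₀` together with a compatible
pair of arrows of `C` and `D`. Hence `C ⊗ D` has projection functors to `C` and `D` and a universal
property: an internal functor `X ⟶ C ⊗ D` is the same as functors `f : X ⟶ C`, `g : X ⟶ D` and a map
`a : X₀ ⟶ C₀ ⊗ D₀` whose two projections are `f₀` and `g₀`. In other words, `C ⊗ D` is the cartesian
lift of the product of `C` and `D` along `j`. Uniqueness is `tensor_hom_ext`, existence is `lift`.

So each structure functor is a structure map of `V` on objects, paired with the functors that a
cartesian product would use; the pairing is legitimate because the structure maps of `V` are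
compatible with the projections `fst` and `snd`, the unit being terminal. Each coherence law splits
in two: on objects it is the same law in `V`, and after the projections it is bookkeeping as for
products. -/

namespace CategoryTheory.SemiCartesianMonoidalCategory

/-! ### Compatibility of the structure maps of `V` with the projections of a tensor product. -/

variable {V : Type u} [Category.{v} V] [SemiCartesianMonoidalCategory V]

/-- Discarding the second factor absorbs `g`, since all maps into the unit agree; interchange and
naturality of the right unitor then carry `f` across. -/
theorem tensorHom_fst {A A' B B' : V} (f : A ⟶ A') (g : B ⟶ B') :
    (f ⊗ₘ g) ≫ fst A' B' = fst A B ≫ f := by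
  have h : g ≫ isTerminalTensorUnit.from B' = isTerminalTensorUnit.from B := toUnit_unique _ _
  rw [fst_def, fst_def, Category.assoc, ← rightUnitor_naturality, MonoidalCategory.tensorHom_def,
    Category.assoc, ← MonoidalCategory.whiskerLeft_comp_assoc, h, ← whisker_exchange_assoc]

theorem tensorHom_snd {A A' B B' : V} (f : A ⟶ A') (g : B ⟶ B') :
    (f ⊗ₘ g) ≫ snd A' B' = snd A B ≫ g := by
  have h : f ≫ isTerminalTensorUnit.from A' = isTerminalTensorUnit.from A := toUnit_unique _ _
  rw [snd_def, snd_def, Category.assoc, ← leftUnitor_naturality, MonoidalCategory.tensorHom_def',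
    Category.assoc, ← MonoidalCategory.comp_whiskerRight_assoc, h, whisker_exchange_assoc]

theorem fst_unit (A : V) : fst A (𝟙_ V) = (ρ_ A).hom := by
  have h : isTerminalTensorUnit.from (𝟙_ V) = 𝟙 (𝟙_ V) := toUnit_unique _ _
  rw [fst_def, h, MonoidalCategory.whiskerLeft_id, Category.id_comp]

theorem snd_unit (A : V) : snd (𝟙_ V) A = (λ_ A).hom := by
  have h : isTerminalTensorUnit.from (𝟙_ V) = 𝟙 (𝟙_ V) := toUnit_unique _ _
  rw [snd_def, h, MonoidalCategory.id_whiskerRight, Category.id_comp]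

theorem associator_hom_fst (A B C : V) :
    (α_ A B C).hom ≫ fst A (B ⊗ C) = fst (A ⊗ B) C ≫ fst A B := by
  -- Discarding `B ⊗ C` at once equals discarding `C` and then `B`; in this form naturality of the
  -- associator and unit coherence apply.
  have h : isTerminalTensorUnit.from (B ⊗ C) = B ◁ isTerminalTensorUnit.from C ≫
      (ρ_ B).hom ≫ isTerminalTensorUnit.from B := toUnit_unique _ _
  rw [fst_def, fst_def, fst_def, h]
  -- `IsTerminal.comp_from` would collapse the factorization `h` again.
  simp [-IsTerminal.comp_from]

theorem associator_hom_snd (A B C : V) :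
    (α_ A B C).hom ≫ snd A (B ⊗ C) = snd A B ▷ C := by
  rw [snd_def, snd_def]
  simp

theorem associator_inv_snd (A B C : V) :
    (α_ A B C).inv ≫ snd (A ⊗ B) C = snd A (B ⊗ C) ≫ snd B C := by
  have h : isTerminalTensorUnit.from (A ⊗ B) = isTerminalTensorUnit.from A ▷ B ≫
      (λ_ B).hom ≫ isTerminalTensorUnit.from B := toUnit_unique _ _
  rw [snd_def, snd_def, snd_def, h]
  simp [-IsTerminal.comp_from]

theorem associator_inv_fst (A B C : V) :
    (α_ A B C).inv ≫ fst (A ⊗ B) C = A ◁ fst B C := by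
  rw [fst_def, fst_def]
  simp

theorem braiding_hom_fst [BraidedCategory V] (A B : V) :
    (β_ A B).hom ≫ fst B A = snd A B := by
  rw [fst_def, snd_def, ← BraidedCategory.braiding_naturality_left_assoc, braiding_rightUnitor]

theorem braiding_hom_snd [BraidedCategory V] (A B : V) :
    (β_ A B).hom ≫ snd B A = fst A B := by
  rw [fst_def, snd_def, ← BraidedCategory.braiding_naturality_right_assoc, braiding_leftUnitor]

end CategoryTheory.SemiCartesianMonoidalCategory

/-! ### The projection functors and the universal property of the internal tensor. -/

namespace IntCat

open SemiCartesianMonoidalCategory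

section

variable {V : Type u} [Category.{v} V] [HasFiniteLimits V]

theorem comp_f₀ {X Y Z : IntCat V} (f : X ⟶ Y) (g : Y ⟶ Z) : (f ≫ g).f₀ = f.f₀ ≫ g.f₀ := rfl

theorem comp_f₁ {X Y Z : IntCat V} (f : X ⟶ Y) (g : Y ⟶ Z) : (f ≫ g).f₁ = f.f₁ ≫ g.f₁ := rfl

/-- The internal functor with given components on objects and on arrows. -/
noncomputable def Hom.mk₀₁ {A B : IntCat V} (f₀ : A.A₀ ⟶ B.A₀) (f₁ : A.A₁ ⟶ B.A₁)
    (hd : A.dom ≫ f₀ = f₁ ≫ B.dom) (hc : A.cod ≫ f₀ = f₁ ≫ B.cod) (hi : A.i ≫ f₁ = f₀ ≫ B.i)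
    (h : ∀ f₂ : A.A₂ ⟶ B.A₂, A.π₁ ≫ f₁ = f₂ ≫ B.π₁ → A.π₂ ≫ f₁ = f₂ ≫ B.π₂ →
      A.comp ≫ f₁ = f₂ ≫ B.comp) : A ⟶ B where
  f₀ := f₀
  f₁ := f₁
  f₂ := B.isPullback.lift (A.π₁ ≫ f₁) (A.π₂ ≫ f₁) (by
    rw [Category.assoc, Category.assoc, ← hc, ← hd, ← Category.assoc, A.isPullback.w,
      Category.assoc])
  dom_comm := hd
  cod_comm := hc
  i_comm := hi
  π₁_comm := (B.isPullback.lift_fst _ _ _).symm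
  π₂_comm := (B.isPullback.lift_snd _ _ _).symm
  -- Only one `f₂` lies over `f₁`, so quantifying `h` over all of them costs nothing and spares its
  -- proofs the explicit pullback lift.
  comp_comm := h _ (B.isPullback.lift_fst _ _ _).symm (B.isPullback.lift_snd _ _ _).symm

end

noncomputable section

variable {V : Type u} [Category.{v} V] [SemiCartesianMonoidalCategory V] [HasFiniteLimits V]

theorem j_fst (A B : V) : j A B ≫ prod.fst = fst A B := prod.lift_fst _ _

theorem j_snd (A B : V) : j A B ≫ prod.snd = snd A B := prod.lift_snd _ _

theorem arrDom_fst (C D : IntCat V) : arrDom C D ≫ fst C.A₀ D.A₀ = arrFst C D ≫ C.dom := by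
  simpa [j_fst] using arrDom_j C D =≫ prod.fst

theorem arrDom_snd (C D : IntCat V) : arrDom C D ≫ snd C.A₀ D.A₀ = arrSnd C D ≫ D.dom := by
  simpa [j_snd] using arrDom_j C D =≫ prod.snd

theorem arrCod_fst (C D : IntCat V) : arrCod C D ≫ fst C.A₀ D.A₀ = arrFst C D ≫ C.cod := by
  simpa [j_fst] using arrCod_j C D =≫ prod.fst

theorem arrCod_snd (C D : IntCat V) : arrCod C D ≫ snd C.A₀ D.A₀ = arrSnd C D ≫ D.cod := by
  simpa [j_snd] using arrCod_j C D =≫ prod.snd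

/-- The projection functor `C ⊗ D ⟶ C`. -/
def fstFunctor (C D : IntCat V) : tensorObj C D ⟶ C where
  f₀ := fst C.A₀ D.A₀
  f₁ := arrFst C D
  f₂ := j₂ C D ≫ prod.fst
  dom_comm := arrDom_fst C D
  cod_comm := arrCod_fst C D
  i_comm := by simpa [j_fst, ← j_fst] using arrI_j₁ C D =≫ prod.fst
  π₁_comm := by simpa using (j₂_π₁ C D =≫ prod.fst).symm
  π₂_comm := by simpa using (j₂_π₂ C D =≫ prod.fst).symm
  comp_comm := by simpa using arrComp_j₁ C D =≫ prod.fst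

/-- The projection functor `C ⊗ D ⟶ D`. -/
def sndFunctor (C D : IntCat V) : tensorObj C D ⟶ D where
  f₀ := snd C.A₀ D.A₀
  f₁ := arrSnd C D
  f₂ := j₂ C D ≫ prod.snd
  dom_comm := arrDom_snd C D
  cod_comm := arrCod_snd C D
  i_comm := by simpa [j_snd, ← j_snd] using arrI_j₁ C D =≫ prod.snd
  π₁_comm := by simpa using (j₂_π₁ C D =≫ prod.snd).symm
  π₂_comm := by simpa using (j₂_π₂ C D =≫ prod.snd).symm
  comp_comm := by simpa using arrComp_j₁ C D =≫ prod.snd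

/-- An internal functor into `C ⊗ D` is determined by its component on objects and its composites
with the projections. -/
theorem tensor_hom_ext {X C D : IntCat V} {f g : X ⟶ tensorObj C D} (h₀ : f.f₀ = g.f₀)
    (h₁ : f ≫ fstFunctor C D = g ≫ fstFunctor C D)
    (h₂ : f ≫ sndFunctor C D = g ≫ sndFunctor C D) : f = g := by
  refine Hom.ext₀₁ h₀ (arr_hom_ext C D ?_ ?_ ?_)
  -- The source and target of the arrow component are `X.dom` and `X.cod` followed by the object
  -- component, so `h₀` settles them; only the `j₁` part needs the projections.
  · exact f.dom_comm.symm.trans ((X.dom ≫= h₀).trans g.dom_comm)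
  · exact f.cod_comm.symm.trans ((X.cod ≫= h₀).trans g.cod_comm)
  · apply Limits.prod.hom_ext
    · simpa [comp_f₁, fstFunctor] using congrArg Hom.f₁ h₁
    · simpa [comp_f₁, sndFunctor] using congrArg Hom.f₁ h₂

section Lift

variable {X C D : IntCat V} (a : X.A₀ ⟶ C.A₀ ⊗ D.A₀) (f : X ⟶ C) (g : X ⟶ D)
  (hf : a ≫ fst C.A₀ D.A₀ = f.f₀) (hg : a ≫ snd C.A₀ D.A₀ = g.f₀)

/-- The component on arrows of the functor into `C ⊗ D` with given composites with the
projections. -/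
def liftArr : X.A₁ ⟶ arr C D :=
  arrLift C D (X.dom ≫ a) (X.cod ≫ a) (prod.lift f.f₁ g.f₁)
    (by
      apply Limits.prod.hom_ext
      · simp [prod.lift_fst, j_fst, hf, f.dom_comm]
      · simp [prod.lift_snd, j_snd, hg, g.dom_comm])
    (by
      apply Limits.prod.hom_ext
      · simp [prod.lift_fst, j_fst, hf, f.cod_comm]
      · simp [prod.lift_snd, j_snd, hg, g.cod_comm])

theorem liftArr_j₁ : liftArr a f g hf hg ≫ j₁ C D = prod.lift f.f₁ g.f₁ := arrLift_j₁ ..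

theorem liftArr_dom : liftArr a f g hf hg ≫ arrDom C D = X.dom ≫ a := arrLift_dom ..

theorem liftArr_cod : liftArr a f g hf hg ≫ arrCod C D = X.cod ≫ a := arrLift_cod ..

/-- The internal functor into `C ⊗ D` with given component on objects and given composites with
the projections. -/
def lift : X ⟶ tensorObj C D :=
  Hom.mk₀₁ (B := tensorObj C D) a (liftArr a f g hf hg)
    (liftArr_dom ..).symm (liftArr_cod ..).symm
    (by
      change X.i ≫ liftArr a f g hf hg = a ≫ arrI C D
      apply arr_hom_ext
      · rw [Category.assoc, liftArr_dom, Category.assoc, arrI_dom, Category.comp_id,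
          ← Category.assoc, X.i_dom, Category.id_comp]
      · rw [Category.assoc, liftArr_cod, Category.assoc, arrI_cod, Category.comp_id,
          ← Category.assoc, X.i_cod, Category.id_comp]
      · rw [Category.assoc, liftArr_j₁, Category.assoc, arrI_j₁]
        apply Limits.prod.hom_ext
        · simp [prod.lift_fst, j, reassoc_of% hf, f.i_comm]
        · simp [prod.lift_snd, j, reassoc_of% hg, g.i_comm])
    (by
      intro m (h₁ : X.π₁ ≫ liftArr a f g hf hg = m ≫ pullback.fst _ _)
        (h₂ : X.π₂ ≫ liftArr a f g hf hg = m ≫ pullback.snd _ _)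
      change X.comp ≫ liftArr a f g hf hg = m ≫ arrComp C D
      apply arr_hom_ext
      · rw [Category.assoc, liftArr_dom, ← Category.assoc, X.comp_dom, Category.assoc,
          Category.assoc, arrComp_dom, ← Category.assoc m, ← h₁, Category.assoc, liftArr_dom]
      · rw [Category.assoc, liftArr_cod, ← Category.assoc, X.comp_cod, Category.assoc,
          Category.assoc, arrComp_cod, ← Category.assoc m, ← h₂, Category.assoc, liftArr_cod]
      -- Over `C₂ × D₂` the family of composable pairs is the pair of `f₂` and `g₂`, so preservation
      -- of composition is inherited from `f` and `g`.
      · have e : m ≫ j₂ C D = prod.lift f.f₂ g.f₂ := by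
          apply comp_j₂
          · rw [← Category.assoc, ← h₁, Category.assoc, liftArr_j₁, prod.comp_lift, prod.lift_map,
              f.π₁_comm, g.π₁_comm]
          · rw [← Category.assoc, ← h₂, Category.assoc, liftArr_j₁, prod.comp_lift, prod.lift_map,
              f.π₂_comm, g.π₂_comm]
        rw [Category.assoc, liftArr_j₁, Category.assoc, arrComp_j₁, ← Category.assoc, e,
          prod.comp_lift, prod.lift_map, f.comp_comm, g.comp_comm])

theorem lift_f₀ : (lift a f g hf hg).f₀ = a := rfl

theorem lift_fst : lift a f g hf hg ≫ fstFunctor C D = f :=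
  Hom.ext₀₁ hf <| by
    change liftArr a f g hf hg ≫ j₁ C D ≫ prod.fst = f.f₁
    rw [← Category.assoc, liftArr_j₁, prod.lift_fst]

theorem lift_snd : lift a f g hf hg ≫ sndFunctor C D = g :=
  Hom.ext₀₁ hg <| by
    change liftArr a f g hf hg ≫ j₁ C D ≫ prod.snd = g.f₁
    rw [← Category.assoc, liftArr_j₁, prod.lift_snd]

end Lift

/-! ### Naturality of the projections and functoriality of the tensor. -/

theorem tensorHom_fstFunctor {C C' D D' : IntCat V} (f : C ⟶ C') (g : D ⟶ D') :
    tensorHom f g ≫ fstFunctor C' D' = fstFunctor C D ≫ f :=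
  Hom.ext₀₁ (tensorHom_fst f.f₀ g.f₀) <| by
    change homArr f g ≫ j₁ C' D' ≫ prod.fst = (j₁ C D ≫ prod.fst) ≫ f.f₁
    rw [← Category.assoc, homArr_j₁, Category.assoc, prod.map_fst, Category.assoc]

theorem tensorHom_sndFunctor {C C' D D' : IntCat V} (f : C ⟶ C') (g : D ⟶ D') :
    tensorHom f g ≫ sndFunctor C' D' = sndFunctor C D ≫ g :=
  Hom.ext₀₁ (tensorHom_snd f.f₀ g.f₀) <| by
    change homArr f g ≫ j₁ C' D' ≫ prod.snd = (j₁ C D ≫ prod.snd) ≫ g.f₁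
    rw [← Category.assoc, homArr_j₁, Category.assoc, prod.map_snd, Category.assoc]

theorem tensorHom_fstFunctor_assoc {C C' D D' X : IntCat V} (f : C ⟶ C') (g : D ⟶ D')
    (h : C' ⟶ X) : tensorHom f g ≫ fstFunctor C' D' ≫ h = fstFunctor C D ≫ f ≫ h := by
  rw [← Category.assoc, tensorHom_fstFunctor, Category.assoc]

theorem tensorHom_sndFunctor_assoc {C C' D D' X : IntCat V} (f : C ⟶ C') (g : D ⟶ D')
    (h : D' ⟶ X) : tensorHom f g ≫ sndFunctor C' D' ≫ h = sndFunctor C D ≫ g ≫ h := by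
  rw [← Category.assoc, tensorHom_sndFunctor, Category.assoc]

theorem tensorHom_id_id (C D : IntCat V) : tensorHom (𝟙 C) (𝟙 D) = 𝟙 (tensorObj C D) :=
  tensor_hom_ext (id_tensorHom_id C.A₀ D.A₀)
    (by rw [tensorHom_fstFunctor, Category.comp_id, Category.id_comp])
    (by rw [tensorHom_sndFunctor, Category.comp_id, Category.id_comp])

theorem tensorHom_comp {C C' C'' D D' D'' : IntCat V} (f : C ⟶ C') (g : D ⟶ D') (f' : C' ⟶ C'')
    (g' : D' ⟶ D'') : tensorHom f g ≫ tensorHom f' g' = tensorHom (f ≫ f') (g ≫ g') :=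
  tensor_hom_ext (tensorHom_comp_tensorHom f.f₀ g.f₀ f'.f₀ g'.f₀)
    (by rw [Category.assoc, tensorHom_fstFunctor, tensorHom_fstFunctor_assoc, tensorHom_fstFunctor])
    (by rw [Category.assoc, tensorHom_sndFunctor, tensorHom_sndFunctor_assoc, tensorHom_sndFunctor])

/-! ### Terminality of the unit, and the unitors. -/

/-- The unique internal functor to the unit. -/
def toUnitFunctor (C : IntCat V) : C ⟶ unit where
  f₀ := toUnit _
  f₁ := toUnit _
  f₂ := toUnit _
  dom_comm := toUnit_unique _ _
  cod_comm := toUnit_unique _ _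
  i_comm := toUnit_unique _ _
  π₁_comm := toUnit_unique _ _
  π₂_comm := toUnit_unique _ _
  comp_comm := toUnit_unique _ _

theorem toUnitFunctor_unique {C : IntCat V} (f g : C ⟶ unit) : f = g :=
  Hom.ext₀₁ (toUnit_unique _ _) (toUnit_unique _ _)

/-- The left unitor of `Cat(V)`. -/
def leftUnitorIso (C : IntCat V) : tensorObj unit C ≅ C where
  hom := sndFunctor unit C
  inv := lift (λ_ C.A₀).inv (toUnitFunctor C) (𝟙 C) (toUnit_unique _ _)
    -- The projection `snd` out of a tensor with the unit is the left unitor of `V`, so the inverse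
    -- unitor is a section of it.
    (by rw [snd_unit, Iso.inv_hom_id]; rfl)
  hom_inv_id := tensor_hom_ext
    (by rw [comp_f₀, lift_f₀]; change snd (𝟙_ V) C.A₀ ≫ _ = 𝟙 _; rw [snd_unit, Iso.hom_inv_id])
    -- The projection to the unit carries no information.
    (toUnitFunctor_unique _ _)
    (by rw [Category.assoc, lift_snd, Category.comp_id, Category.id_comp])
  inv_hom_id := lift_snd ..

/-- The right unitor of `Cat(V)`. -/
def rightUnitorIso (C : IntCat V) : tensorObj C unit ≅ C where
  hom := fstFunctor C unit
  inv := lift (ρ_ C.A₀).inv (𝟙 C) (toUnitFunctor C)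
    (by rw [fst_unit, Iso.inv_hom_id]; rfl) (toUnit_unique _ _)
  hom_inv_id := tensor_hom_ext
    (by rw [comp_f₀, lift_f₀]; change fst C.A₀ (𝟙_ V) ≫ _ = 𝟙 _; rw [fst_unit, Iso.hom_inv_id])
    (by rw [Category.assoc, lift_fst, Category.comp_id, Category.id_comp])
    (toUnitFunctor_unique _ _)
  inv_hom_id := lift_fst ..

/-! ### The associator. -/

section Associator

variable (C D E : IntCat V)

/-- The associator of `Cat(V)`. -/
def assocHom : tensorObj (tensorObj C D) E ⟶ tensorObj C (tensorObj D E) :=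
  -- The second composite is the tensor of a projection with an identity: its object component is
  -- `snd ▷ E`, which is what `associator_hom_snd` yields.
  lift (α_ C.A₀ D.A₀ E.A₀).hom (fstFunctor (tensorObj C D) E ≫ fstFunctor C D)
    (tensorHom (sndFunctor C D) (𝟙 E)) (associator_hom_fst _ _ _)
    ((associator_hom_snd _ _ _).trans (tensorHom_id _ _).symm)

/-- The inverse of the associator of `Cat(V)`. -/
def assocInv : tensorObj C (tensorObj D E) ⟶ tensorObj (tensorObj C D) E :=
  lift (α_ C.A₀ D.A₀ E.A₀).inv (tensorHom (𝟙 C) (fstFunctor D E))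
    (sndFunctor C (tensorObj D E) ≫ sndFunctor D E)
    ((associator_inv_fst _ _ _).trans (id_tensorHom _ _).symm) (associator_inv_snd _ _ _)

theorem assocHom_fst :
    assocHom C D E ≫ fstFunctor C (tensorObj D E) =
      fstFunctor (tensorObj C D) E ≫ fstFunctor C D := lift_fst ..

theorem assocHom_snd :
    assocHom C D E ≫ sndFunctor C (tensorObj D E) = tensorHom (sndFunctor C D) (𝟙 E) := lift_snd ..

theorem assocInv_fst :
    assocInv C D E ≫ fstFunctor (tensorObj C D) E = tensorHom (𝟙 C) (fstFunctor D E) := lift_fst ..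

theorem assocInv_snd :
    assocInv C D E ≫ sndFunctor (tensorObj C D) E =
      sndFunctor C (tensorObj D E) ≫ sndFunctor D E := lift_snd ..

variable {C D E}

/-- An internal functor into `C ⊗ (D ⊗ E)` is determined by its component on objects and its
composites with the three projections. -/
theorem tensor_tensor_hom_ext {X : IntCat V} {f g : X ⟶ tensorObj C (tensorObj D E)}
    (h₀ : f.f₀ = g.f₀)
    (h₁ : f ≫ fstFunctor C (tensorObj D E) = g ≫ fstFunctor C (tensorObj D E))
    (h₂ : f ≫ sndFunctor C (tensorObj D E) ≫ fstFunctor D E =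
      g ≫ sndFunctor C (tensorObj D E) ≫ fstFunctor D E)
    (h₃ : f ≫ sndFunctor C (tensorObj D E) ≫ sndFunctor D E =
      g ≫ sndFunctor C (tensorObj D E) ≫ sndFunctor D E) : f = g :=
  -- Agreement on objects after the projection to `D ⊗ E` already follows from `h₀`, so one check on
  -- objects serves both levels.
  tensor_hom_ext h₀ h₁ (tensor_hom_ext (by rw [comp_f₀, comp_f₀, h₀])
    (by simpa only [Category.assoc] using h₂) (by simpa only [Category.assoc] using h₃))

/-- An internal functor into `(C ⊗ D) ⊗ E` is determined by its component on objects and its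
composites with the three projections. -/
theorem tensor_tensor_hom_ext' {X : IntCat V} {f g : X ⟶ tensorObj (tensorObj C D) E}
    (h₀ : f.f₀ = g.f₀)
    (h₁ : f ≫ fstFunctor (tensorObj C D) E ≫ fstFunctor C D =
      g ≫ fstFunctor (tensorObj C D) E ≫ fstFunctor C D)
    (h₂ : f ≫ fstFunctor (tensorObj C D) E ≫ sndFunctor C D =
      g ≫ fstFunctor (tensorObj C D) E ≫ sndFunctor C D)
    (h₃ : f ≫ sndFunctor (tensorObj C D) E = g ≫ sndFunctor (tensorObj C D) E) : f = g :=
  tensor_hom_ext h₀ (tensor_hom_ext (by rw [comp_f₀, comp_f₀, h₀])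
    (by simpa only [Category.assoc] using h₁) (by simpa only [Category.assoc] using h₂)) h₃

variable (C D E)

theorem assocHom_fst_assoc {X : IntCat V} (h : C ⟶ X) :
    assocHom C D E ≫ fstFunctor C (tensorObj D E) ≫ h =
      fstFunctor (tensorObj C D) E ≫ fstFunctor C D ≫ h := by
  rw [← Category.assoc, assocHom_fst, Category.assoc]

/-- With `assocHom_fst` and `assocHom_snd_snd`, this says that the associator respects the three
projections. These rules and its object component are all that the coherence laws use. -/
theorem assocHom_snd_fst :
    assocHom C D E ≫ sndFunctor C (tensorObj D E) ≫ fstFunctor D E =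
      fstFunctor (tensorObj C D) E ≫ sndFunctor C D := by
  rw [← Category.assoc, assocHom_snd, tensorHom_fstFunctor]

theorem assocHom_snd_fst_assoc {X : IntCat V} (h : D ⟶ X) :
    assocHom C D E ≫ sndFunctor C (tensorObj D E) ≫ fstFunctor D E ≫ h =
      fstFunctor (tensorObj C D) E ≫ sndFunctor C D ≫ h := by
  simpa only [Category.assoc] using assocHom_snd_fst C D E =≫ h

theorem assocHom_snd_snd :
    assocHom C D E ≫ sndFunctor C (tensorObj D E) ≫ sndFunctor D E =
      sndFunctor (tensorObj C D) E := by
  rw [← Category.assoc, assocHom_snd, tensorHom_sndFunctor, Category.comp_id]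

theorem assocHom_snd_snd_assoc {X : IntCat V} (h : E ⟶ X) :
    assocHom C D E ≫ sndFunctor C (tensorObj D E) ≫ sndFunctor D E ≫ h =
      sndFunctor (tensorObj C D) E ≫ h := by
  simpa only [Category.assoc] using assocHom_snd_snd C D E =≫ h

theorem assocInv_fst_fst :
    assocInv C D E ≫ fstFunctor (tensorObj C D) E ≫ fstFunctor C D =
      fstFunctor C (tensorObj D E) := by
  rw [← Category.assoc, assocInv_fst, tensorHom_fstFunctor, Category.comp_id]

theorem assocInv_fst_snd :
    assocInv C D E ≫ fstFunctor (tensorObj C D) E ≫ sndFunctor C D =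
      sndFunctor C (tensorObj D E) ≫ fstFunctor D E := by
  rw [← Category.assoc, assocInv_fst, tensorHom_sndFunctor]

/-- The associator of `Cat(V)`, as an isomorphism. -/
def assocIso : tensorObj (tensorObj C D) E ≅ tensorObj C (tensorObj D E) where
  hom := assocHom C D E
  inv := assocInv C D E
  hom_inv_id := tensor_tensor_hom_ext' (α_ C.A₀ D.A₀ E.A₀).hom_inv_id
    (by rw [Category.assoc, assocInv_fst_fst, assocHom_fst, Category.id_comp])
    (by rw [Category.assoc, assocInv_fst_snd, assocHom_snd_fst, Category.id_comp])
    (by rw [Category.assoc, assocInv_snd, assocHom_snd_snd, Category.id_comp])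
  inv_hom_id := tensor_tensor_hom_ext (α_ C.A₀ D.A₀ E.A₀).inv_hom_id
    (by rw [Category.assoc, assocHom_fst, assocInv_fst_fst, Category.id_comp])
    (by rw [Category.assoc, assocHom_snd_fst, assocInv_fst_snd, Category.id_comp])
    (by rw [Category.assoc, assocHom_snd_snd, assocInv_snd, Category.id_comp])

end Associator

/-! ### Coherence: naturality, pentagon and triangle. -/

theorem assocHom_naturality {C C' D D' E E' : IntCat V} (f : C ⟶ C') (g : D ⟶ D') (h : E ⟶ E') :
    tensorHom (tensorHom f g) h ≫ assocHom C' D' E' =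
      assocHom C D E ≫ tensorHom f (tensorHom g h) := by
  apply tensor_tensor_hom_ext (associator_naturality f.f₀ g.f₀ h.f₀)
  · simp only [Category.assoc, assocHom_fst, assocHom_fst_assoc, tensorHom_fstFunctor,
      tensorHom_fstFunctor_assoc]
  · simp only [Category.assoc, assocHom_snd_fst, assocHom_snd_fst_assoc, tensorHom_fstFunctor,
      tensorHom_sndFunctor, tensorHom_fstFunctor_assoc, tensorHom_sndFunctor_assoc]
  · simp only [Category.assoc, assocHom_snd_snd, assocHom_snd_snd_assoc,
      tensorHom_sndFunctor, tensorHom_sndFunctor_assoc]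

theorem assocHom_pentagon (B C D E : IntCat V) :
    tensorHom (assocHom B C D) (𝟙 E) ≫ assocHom B (tensorObj C D) E ≫
        tensorHom (𝟙 B) (assocHom C D E) =
      assocHom (tensorObj B C) D E ≫ assocHom B C (tensorObj D E) := by
  -- The pentagon of `V`. It is kept as a named fact because it is needed for the outer tensor and
  -- again for the three inner factors.
  have h₀ : (tensorHom (assocHom B C D) (𝟙 E) ≫ assocHom B (tensorObj C D) E ≫
        tensorHom (𝟙 B) (assocHom C D E)).f₀ =
      (assocHom (tensorObj B C) D E ≫ assocHom B C (tensorObj D E)).f₀ := by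
    change ((α_ B.A₀ C.A₀ D.A₀).hom ⊗ₘ 𝟙 E.A₀) ≫ (α_ B.A₀ (C.A₀ ⊗ D.A₀) E.A₀).hom ≫
      (𝟙 B.A₀ ⊗ₘ (α_ C.A₀ D.A₀ E.A₀).hom) = _
    rw [id_tensorHom, tensorHom_id]
    exact MonoidalCategory.pentagon ..
  apply tensor_hom_ext h₀
  · simp only [Category.assoc, assocHom_fst, assocHom_fst_assoc, tensorHom_fstFunctor,
      tensorHom_fstFunctor_assoc, Category.comp_id]
  apply tensor_tensor_hom_ext (by rw [comp_f₀, h₀, ← comp_f₀])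
  · simp only [Category.assoc, assocHom_fst, assocHom_fst_assoc, assocHom_snd_fst,
      assocHom_snd_fst_assoc, tensorHom_sndFunctor, tensorHom_fstFunctor_assoc]
  · simp only [Category.assoc, assocHom_snd_fst, assocHom_snd_fst_assoc, assocHom_snd_snd_assoc,
      assocHom_snd_snd, tensorHom_sndFunctor_assoc, tensorHom_fstFunctor_assoc]
  · simp only [Category.assoc, assocHom_snd_snd, assocHom_snd_snd_assoc,
      tensorHom_sndFunctor, Category.comp_id]

/-- The unitors are projection functors, with the unitors of `V` as object components by `snd_unit`
and `fst_unit`; on objects the law is therefore the triangle of `V`. -/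
theorem assocHom_triangle (C D : IntCat V) :
    assocHom C unit D ≫ tensorHom (𝟙 C) (sndFunctor unit D) =
      tensorHom (fstFunctor C unit) (𝟙 D) := by
  apply tensor_hom_ext
  · change (α_ C.A₀ (𝟙_ V) D.A₀).hom ≫ (𝟙 C.A₀ ⊗ₘ snd (𝟙_ V) D.A₀) =
      fst C.A₀ (𝟙_ V) ⊗ₘ 𝟙 D.A₀
    rw [id_tensorHom, tensorHom_id, snd_unit, fst_unit, MonoidalCategory.triangle]
  · rw [Category.assoc, tensorHom_fstFunctor, tensorHom_fstFunctor, assocHom_fst_assoc,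
      Category.comp_id]
  · rw [Category.assoc, tensorHom_sndFunctor, tensorHom_sndFunctor, assocHom_snd_snd,
      Category.comp_id]

/-- The monoidal structure on `Cat(V)`. -/
abbrev monoidal : MonoidalCategory (IntCat V) :=
  letI : MonoidalCategoryStruct (IntCat V) :=
    tensorStruct assocIso leftUnitorIso rightUnitorIso
  MonoidalCategory.ofTensorHom
    (id_tensorHom_id := tensorHom_id_id)
    -- Whiskering is by definition the tensor with an identity functor.
    (id_tensorHom := fun _ _ _ _ => rfl)
    (tensorHom_id := fun _ _ => rfl)
    (tensorHom_comp_tensorHom := tensorHom_comp)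
    (associator_naturality := assocHom_naturality)
    -- As the unitors are projections, their naturality is that of the projections.
    (leftUnitor_naturality := fun f => tensorHom_sndFunctor (𝟙 unit) f)
    (rightUnitor_naturality := fun f => tensorHom_fstFunctor f (𝟙 unit))
    (pentagon := assocHom_pentagon)
    (triangle := assocHom_triangle)

/-! ### The symmetry. -/

section Symmetric

variable [SymmetricCategory V]

/-- The symmetry of `Cat(V)`. -/
def braidHom (C D : IntCat V) : tensorObj C D ⟶ tensorObj D C :=
  lift (β_ C.A₀ D.A₀).hom (sndFunctor C D) (fstFunctor C D)
    (braiding_hom_fst _ _) (braiding_hom_snd _ _)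

theorem braidHom_fst (C D : IntCat V) : braidHom C D ≫ fstFunctor D C = sndFunctor C D :=
  lift_fst ..

theorem braidHom_snd (C D : IntCat V) : braidHom C D ≫ sndFunctor D C = fstFunctor C D :=
  lift_snd ..

theorem braidHom_fst_assoc (C D : IntCat V) {X : IntCat V} (h : D ⟶ X) :
    braidHom C D ≫ fstFunctor D C ≫ h = sndFunctor C D ≫ h := by
  rw [← Category.assoc, braidHom_fst]

theorem braidHom_snd_assoc (C D : IntCat V) {X : IntCat V} (h : C ⟶ X) :
    braidHom C D ≫ sndFunctor D C ≫ h = fstFunctor C D ≫ h := by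
  rw [← Category.assoc, braidHom_snd]

/-- The one law whose object part needs a symmetry of `V` and not just a braiding. It gives both
inverse laws of `braidIso` as well as the symmetry axiom. -/
theorem braidHom_braidHom (C D : IntCat V) : braidHom C D ≫ braidHom D C = 𝟙 (tensorObj C D) :=
  tensor_hom_ext (SymmetricCategory.symmetry C.A₀ D.A₀)
    (by rw [Category.assoc, braidHom_fst, braidHom_snd, Category.id_comp])
    (by rw [Category.assoc, braidHom_snd, braidHom_fst, Category.id_comp])

/-- The symmetry of `Cat(V)`, as an isomorphism. -/
def braidIso (C D : IntCat V) : tensorObj C D ≅ tensorObj D C where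
  hom := braidHom C D
  inv := braidHom D C
  hom_inv_id := braidHom_braidHom C D
  inv_hom_id := braidHom_braidHom D C

theorem braidHom_naturality {C C' D D' : IntCat V} (f : C ⟶ C') (g : D ⟶ D') :
    tensorHom f g ≫ braidHom C' D' = braidHom C D ≫ tensorHom g f :=
  tensor_hom_ext (BraidedCategory.braiding_naturality f.f₀ g.f₀)
    (by rw [Category.assoc, Category.assoc, braidHom_fst, tensorHom_sndFunctor,
      tensorHom_fstFunctor, braidHom_fst_assoc])
    (by rw [Category.assoc, Category.assoc, braidHom_snd, tensorHom_fstFunctor,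
      tensorHom_sndFunctor, braidHom_snd_assoc])

/-- On objects this is the hexagon of `V`; after the projections, both sides permute the three
factors in the same way. -/
theorem braidHom_hexagon_forward (C D E : IntCat V) :
    assocHom C D E ≫ braidHom C (tensorObj D E) ≫ assocHom D E C =
      tensorHom (braidHom C D) (𝟙 E) ≫ assocHom D C E ≫ tensorHom (𝟙 D) (braidHom C E) := by
  apply tensor_tensor_hom_ext
  · change _ = ((β_ C.A₀ D.A₀).hom ⊗ₘ 𝟙 E.A₀) ≫ (α_ D.A₀ C.A₀ E.A₀).hom ≫
      (𝟙 D.A₀ ⊗ₘ (β_ C.A₀ E.A₀).hom)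
    rw [id_tensorHom, tensorHom_id]
    exact BraidedCategory.hexagon_forward ..
  · simp only [Category.assoc, assocHom_fst, assocHom_snd_fst,
      braidHom_fst_assoc, braidHom_fst, tensorHom_fstFunctor, tensorHom_fstFunctor_assoc,
      Category.comp_id]
  · simp only [Category.assoc, assocHom_snd_fst, assocHom_snd_snd, braidHom_fst_assoc,
      braidHom_fst, tensorHom_sndFunctor_assoc, tensorHom_sndFunctor, Category.comp_id]
  · simp only [Category.assoc, assocHom_snd_snd, assocHom_fst, assocHom_snd_fst, braidHom_snd,
      tensorHom_sndFunctor_assoc, tensorHom_fstFunctor_assoc]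

theorem braidHom_hexagon_reverse (C D E : IntCat V) :
    assocInv C D E ≫ braidHom (tensorObj C D) E ≫ assocInv E C D =
      tensorHom (𝟙 C) (braidHom D E) ≫ assocInv C E D ≫ tensorHom (braidHom C E) (𝟙 D) := by
  apply tensor_tensor_hom_ext'
  · change _ = (𝟙 C.A₀ ⊗ₘ (β_ D.A₀ E.A₀).hom) ≫ (α_ C.A₀ E.A₀ D.A₀).inv ≫
      ((β_ C.A₀ E.A₀).hom ⊗ₘ 𝟙 D.A₀)
    rw [id_tensorHom, tensorHom_id]
    exact BraidedCategory.hexagon_reverse ..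
  · simp only [Category.assoc, assocInv_fst_fst, assocInv_snd, assocInv_fst_snd, braidHom_fst,
      tensorHom_fstFunctor_assoc, tensorHom_sndFunctor_assoc]
  · simp only [Category.assoc, assocInv_fst_snd, assocInv_fst_fst, braidHom_snd_assoc,
      braidHom_snd, tensorHom_fstFunctor_assoc, tensorHom_fstFunctor, Category.comp_id]
  · simp only [Category.assoc, assocInv_snd, assocInv_fst_snd,
      braidHom_snd_assoc, braidHom_snd, tensorHom_sndFunctor, tensorHom_sndFunctor_assoc,
      Category.comp_id]

/-- The symmetric monoidal structure on `Cat(V)`. -/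
abbrev symmetric : @SymmetricCategory (IntCat V) _ monoidal :=
  letI : MonoidalCategory (IntCat V) := monoidal
  { braiding := braidIso
    braiding_naturality_right := fun X _ _ f => braidHom_naturality (𝟙 X) f
    braiding_naturality_left := fun f Z => braidHom_naturality f (𝟙 Z)
    hexagon_forward := braidHom_hexagon_forward
    hexagon_reverse := braidHom_hexagon_reverse
    symmetry := braidHom_braidHom }

end Symmetric

end

end IntCat

/-! ### The theorem. -/

theorem mainTheorem2 {V : Type u} [Category.{v} V] [SemiCartesianMonoidalCategory V]
    [HasFiniteLimits V] :
    ∃ (α : ∀ C D E : IntCat V, IntCat.tensorObj (IntCat.tensorObj C D) E ≅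
          IntCat.tensorObj C (IntCat.tensorObj D E))
      (l : ∀ C : IntCat V, IntCat.tensorObj IntCat.unit C ≅ C)
      (r : ∀ C : IntCat V, IntCat.tensorObj C IntCat.unit ≅ C),
      (∀ C D E : IntCat V,
        (α C D E).hom.f₀ = (α_ C.A₀ D.A₀ E.A₀).hom ∧
        (α C D E).hom.f₁ ≫ IntCat.arrFst C (IntCat.tensorObj D E) =
          IntCat.arrFst (IntCat.tensorObj C D) E ≫ IntCat.arrFst C D ∧
        (α C D E).hom.f₁ ≫ IntCat.arrSnd C (IntCat.tensorObj D E) ≫ IntCat.arrFst D E =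
          IntCat.arrFst (IntCat.tensorObj C D) E ≫ IntCat.arrSnd C D ∧
        (α C D E).hom.f₁ ≫ IntCat.arrSnd C (IntCat.tensorObj D E) ≫ IntCat.arrSnd D E =
          IntCat.arrSnd (IntCat.tensorObj C D) E) ∧
      (∀ C : IntCat V,
        (l C).hom.f₀ = (λ_ C.A₀).hom ∧ (l C).hom.f₁ = IntCat.arrSnd IntCat.unit C) ∧
      (∀ C : IntCat V,
        (r C).hom.f₀ = (ρ_ C.A₀).hom ∧ (r C).hom.f₁ = IntCat.arrFst C IntCat.unit) ∧
      IsMonoidal (IntCat.tensorStruct α l r) ∧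
      ∀ [SymmetricCategory V],
        ∃ β : ∀ C D : IntCat V, IntCat.tensorObj C D ≅ IntCat.tensorObj D C,
          (∀ C D : IntCat V,
            (β C D).hom.f₀ = (β_ C.A₀ D.A₀).hom ∧
            (β C D).hom.f₁ ≫ IntCat.arrFst D C = IntCat.arrSnd C D ∧
            (β C D).hom.f₁ ≫ IntCat.arrSnd D C = IntCat.arrFst C D) ∧
          IsSymmetricMonoidal (IntCat.tensorStruct α l r) β := by
  refine ⟨IntCat.assocIso, IntCat.leftUnitorIso, IntCat.rightUnitorIso,
    fun C D E => ⟨rfl, ?_, ?_, ?_⟩, fun C => ⟨SemiCartesianMonoidalCategory.snd_unit _, rfl⟩,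
    -- The data underlying `IntCat.monoidal` are `tensorStruct` of these isomorphisms by definition,
    -- so the constructor of `IsMonoidal` applies directly.
    fun C => ⟨SemiCartesianMonoidalCategory.fst_unit _, rfl⟩, ⟨IntCat.monoidal⟩, ?_⟩
  -- The conditions on arrows are the arrow components of equations between functors.
  · exact congrArg IntCat.Hom.f₁ (IntCat.assocHom_fst C D E)
  · exact congrArg IntCat.Hom.f₁ (IntCat.assocHom_snd_fst C D E)
  · exact congrArg IntCat.Hom.f₁ (IntCat.assocHom_snd_snd C D E)
  · intro _
    exact ⟨IntCat.braidIso, fun C D => ⟨rfl, congrArg IntCat.Hom.f₁ (IntCat.braidHom_fst C D),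
      congrArg IntCat.Hom.f₁ (IntCat.braidHom_snd C D)⟩, ⟨IntCat.monoidal, IntCat.symmetric⟩⟩
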